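/- **Theorem (Strong converse of the SQL for information replication).** Let $\mathcal H$ be a finite-dimensional complex Hilbert space, $H=H^\dagger$ an operator on $\mathcal H$, and $|\psi\rangle\in\mathcal H$ a unit vector that is not an eigenvector of $H$. For $t\in\mathbb R$ let $|\psi_t\rangle=e^{-itH}|\psi\rangle$ be the corresponding clock states. A *replication process* from $N$ to $M$ copies is a completely positive, trace non-increasing linear map $\mathcal P_{\rm yes}$ from the operators on $\mathcal H^{\otimes N}$ to the operators on $\mathcal H^{\otimes M}$. It succeeds on the input $\psi_t^{\otimes N}$ with probability $p_{\rm yes}(t)=\mathrm{Tr}\,\mathcal P_{\rm yes}\big(|\psi_t\rangle\langle\psi_t|^{\otimes N}\big)$; its success probability is $p_{\rm yes}=\sup_t p_{\rm yes}(t)$ (for processes that are covariant under $e^{-itH}$, $p_{\rm yes}(t)$ does not depend on $t$), and its fidelity is the worst-case conditional fidelity $$F=\inf_{t:\,p_{\rm yes}(t)>0}\frac{\langle\psi_t|^{\otimes M}\,\mathcal P_{\rm yes}\big(|\psi_t\rangle\langle\psi_t|^{\otimes N}\big)\,|\psi_t\rangle^{\otimes M}}{p_{\rm yes}(t)} .$$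 1. Let $0<\epsilon\le 1$, $c>0$, $\delta<\epsilon$, and let $(\mathcal P_{{\rm yes},N})_{N\in\mathbb N}$ be a sequence of replication processes, the $N$-th one from $N$ to $M=M(N)$ copies, with $M(N)\ge c\,N^{1+\epsilon}$ for all sufficiently large $N$. If the success probabilities $p_{{\rm yes},N}$ satisfy $$\liminf_{N\to\infty}\frac{p_{{\rm yes},N}}{e^{-N^\delta}}>0 ,$$ then the fidelity $F_N$ of the $N$-th process tends to $0$ as $N\to\infty$. 2. In particular, deterministic processes cannot reliably replicate clock states at a rate above $1$ (the SQL for replication): if $p_{{\rm yes},N}(t)=1$ for all $t$ and $N$, and $M(N)\ge N+a\,N^{\alpha}$ for all sufficiently large $N$, with some $\alpha>1$ and $a>0$, then $F_N\to0$ as $N\to\infty$; hence the replication error $1-F_N$ does not vanish. -/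

import Mathlib

open Filter Topology
open scoped CStarAlgebra

noncomputable section

namespace QuantumReplication

/-- Operators on a Hilbert space; for finite-dimensional complex `E` this is the C⋆-algebra of all
operators, with the Loewner order. -/
abbrev Op (E : Type*) [NormedAddCommGroup E] [InnerProductSpace ℂ E] : Type _ := E →L[ℂ] E

/-- A finite-dimensional complex Hilbert space `ℋ`, with an orthonormal basis labelled by `ι`. -/
abbrev Sys (ι : Type*) : Type _ := EuclideanSpace ℂ ι

/-- The tensor power `ℋ^{⊗ N}`: its product orthonormal basis is labelled by `N`-tuples of
labels. -/
abbrev Copies (ι : Type*) (N : ℕ) : Type _ := EuclideanSpace ℂ (Fin N → ι)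

variable {ι : Type*} [Fintype ι]

/-- The product vector `φ^{⊗ N}`. -/
def tensorPow (N : ℕ) (φ : Sys ι) : Copies ι N :=
  WithLp.toLp 2 (fun f : Fin N → ι => ∏ i, φ (f i))

/-- The rank-one operator `|φ⟩⟨φ|`. -/
def dyad {E : Type*} [NormedAddCommGroup E] [InnerProductSpace ℂ E] (φ : E) : Op E :=
  InnerProductSpace.rankOne ℂ φ φ

/-- The trace of an operator. -/
def tr {E : Type*} [NormedAddCommGroup E] [InnerProductSpace ℂ E] (A : Op E) : ℂ :=
  LinearMap.trace ℂ E (A : E →ₗ[ℂ] E)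

/-- The clock state `|ψ_t⟩ = exp(-i t H) |ψ⟩`. -/
def clockState (H : Op (Sys ι)) (ψ : Sys ι) (t : ℝ) : Sys ι :=
  NormedSpace.exp ((-(Complex.I * (t : ℂ))) • H) ψ

/-- A (probabilistic) replication process from `N` to `M` copies, i.e. the successful branch
`𝒫_yes` of a two-outcome quantum instrument: a completely positive, trace non-increasing linear map
from operators on `ℋ^{⊗ N}` to operators on `ℋ^{⊗ M}`. -/
structure ReplicationProcess (ι : Type*) [Fintype ι] (N M : ℕ) where
  /-- the completely positive map -/
  toCP : Op (Copies ι N) →CP Op (Copies ι M)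
  trace_le : ∀ ρ : Op (Copies ι N), 0 ≤ ρ → (tr (toCP ρ)).re ≤ (tr ρ).re

variable {N M : ℕ}

/-- The probability `Tr 𝒫_yes(|ψ_t⟩⟨ψ_t|^{⊗ N})` that the process succeeds on `N` copies of the
clock state `ψ_t`. -/
def successProbAt (H : Op (Sys ι)) (ψ : Sys ι) (P : ReplicationProcess ι N M) (t : ℝ) : ℝ :=
  (tr (P.toCP (dyad (tensorPow N (clockState H ψ t))))).re

/-- The success probability of the process. It does not depend on `t` when the process is covariant
under the time evolution; in general the largest value over `t` is taken, so that a lower bound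
on it is implied by the same lower bound on the worst-case value, on an average
value, or on the value at some particular time. -/
def successProb (H : Op (Sys ι)) (ψ : Sys ι) (P : ReplicationProcess ι N M) : ℝ :=
  ⨆ t : ℝ, successProbAt H ψ P t

/-- The fidelity of the output, conditional on success, with `M` perfect copies of `ψ_t`:
`⟨ψ_t|^{⊗ M} 𝒫_yes(|ψ_t⟩⟨ψ_t|^{⊗ N}) |ψ_t⟩^{⊗ M} / Tr 𝒫_yes(|ψ_t⟩⟨ψ_t|^{⊗ N})`. -/
def fidelityAt (H : Op (Sys ι)) (ψ : Sys ι) (P : ReplicationProcess ι N M) (t : ℝ) : ℝ :=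
  (inner ℂ (tensorPow M (clockState H ψ t))
    (P.toCP (dyad (tensorPow N (clockState H ψ t))) (tensorPow M (clockState H ψ t)))).re /
      successProbAt H ψ P t

/-- The worst-case fidelity: the infimum over all input clock states (those on which the process
can succeed at all, as the conditional fidelity is undefined on the others). -/
def worstFidelity (H : Op (Sys ι)) (ψ : Sys ι) (P : ReplicationProcess ι N M) : ℝ :=
  ⨅ t : {t : ℝ // 0 < successProbAt H ψ P t}, fidelityAt H ψ P t

/-- On clock states the process never fails; every trace-preserving process (quantum channel) has
this property when `ψ` is a unit vector. -/
def IsDeterministic (H : Op (Sys ι)) (ψ : Sys ι) (P : ReplicationProcess ι N M) : Prop :=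
  ∀ t : ℝ, successProbAt H ψ P t = 1

/-- The number of extra copies grows at least like `N^α`: `M(N) ≥ N + a N^α` for large `N`, for some
constant `a > 0`. -/
def HasRateAtLeast (M : ℕ → ℕ) (α : ℝ) : Prop :=
  ∃ a : ℝ, 0 < a ∧ ∀ᶠ N : ℕ in atTop, (N : ℝ) + a * (N : ℝ) ^ α ≤ (M N : ℝ)

/-- A sequence of replication processes is reliable if its replication error (the worst-case
infidelity) vanishes for large `N`. -/
def IsReliable (H : Op (Sys ι)) (ψ : Sys ι) {M : ℕ → ℕ}
    (P : ∀ N : ℕ, ReplicationProcess ι N (M N)) : Prop :=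
  Tendsto (fun N : ℕ => 1 - worstFidelity H ψ (P N)) atTop (𝓝 0)

end QuantumReplication

end

open QuantumReplication

/-! The output of a process that succeeds with probability about `p ≥ q exp(-N^δ)` cannot change
quickly with `t`, while `M` output clocks tell very close times apart. Centre the energy so that
`⟨ψ, Tψ⟩ = 0`. For a functional `l` dominated by the trace, `t ↦ l (𝒫(|ψ_t⟩⟨ψ_t|^{⊗N}))` extends to
an entire function, bounded by `p` on the real line. Centering makes `exp(yT)ψ` grow only
quadratically in the exponent, so the extension is at most `4 exp(6 N^δ)` on a strip of half-width
`Y` of order `N^((δ-1)/2)`. This is at most `p exp L` with `L` of order `N^δ`, so a Bernstein-type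
inequality gives a Lipschitz constant `e p L / Y`, of order `p N^((1+δ)/2)`
(`norm_sub_le_of_bounded_on_strip`, `apply_dyad_clockState_lipschitz`). Powers `ψ_t^{⊗M}` with `M ≥
c N^(1+ε)` become almost orthogonal at spacings well above `N^(-(1+ε)/2)` (`norm_inner_exp_le`). As
`δ < ε`, some spacing `τ` lies between the two scales. Over `J` times with spacing `τ` the output is
almost constant, yet it must overlap with `J` almost orthogonal vectors; its trace bounds the total
overlap (`sum_inner_apply_le_tr`), so the fidelity is at most about `4 / J`
(`mul_worstFidelity_le`). Here `J` is arbitrary. -/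

namespace QuantumReplication

open scoped ComplexConjugate
open InnerProductSpace (rankOne)

/-! ### Positive operators and almost orthonormal families. -/

section LinearAlgebra

variable {E : Type*} [NormedAddCommGroup E] [InnerProductSpace ℂ E]

/-- A Bessel inequality for almost orthonormal families. -/
lemma sum_norm_inner_sq_le {κ : Type*} [Fintype κ] {γ : ℝ} (hγ : 0 ≤ γ) {φ : κ → E}
    (h1 : ∀ j, ‖φ j‖ = 1) (h2 : ∀ i j, i ≠ j → ‖inner ℂ (φ i) (φ j)‖ ≤ γ) (x : E) :
    ∑ j, ‖inner ℂ (φ j) x‖ ^ 2 ≤ (1 + Fintype.card κ * γ) * ‖x‖ ^ 2 := by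
  classical
  set a : κ → ℂ := fun j => inner ℂ (φ j) x with ha
  set S : ℝ := ∑ j, ‖a j‖ ^ 2 with hS
  -- Duality: `⟨y, x⟩ = S`, and almost orthogonality bounds `‖y‖²` by a multiple of `S`;
  -- Cauchy–Schwarz then leaves one factor of `S` to cancel.
  set y : E := ∑ j, a j • φ j with hy
  have hS0 : 0 ≤ S := Finset.sum_nonneg fun _ _ => sq_nonneg _
  have hyx : inner ℂ y x = (S : ℂ) := by
    simp only [hy, sum_inner, inner_smul_left, hS, Complex.ofReal_sum]
    refine Finset.sum_congr rfl fun j _ => ?_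
    rw [Complex.conj_mul']
    norm_cast
  have hyy : ‖y‖ ^ 2 ≤ (1 + Fintype.card κ * γ) * S := by
    have e1 : inner ℂ y y = ∑ i, ∑ j, conj (a i) * a j * inner ℂ (φ i) (φ j) := by
      simp only [hy, sum_inner, inner_smul_left, inner_sum, inner_smul_right, Finset.mul_sum]
      rw [Finset.sum_comm]
      exact Finset.sum_congr rfl fun i _ => Finset.sum_congr rfl fun j _ => by ring
    have e2 : ‖y‖ ^ 2 = ‖inner ℂ y y‖ := by
      rw [inner_self_eq_norm_sq_to_K]; simp
    have e3 : ∀ i j, ‖conj (a i) * a j * inner ℂ (φ i) (φ j)‖ ≤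
        (if i = j then ‖a i‖ ^ 2 else 0) + γ * (‖a i‖ * ‖a j‖) := by
      intro i j
      have h0 : 0 ≤ ‖a i‖ * ‖a j‖ := by positivity
      rw [norm_mul, norm_mul, RCLike.norm_conj]
      split_ifs with hij
      · subst hij
        rw [inner_self_eq_norm_sq_to_K, h1]
        have : 0 ≤ γ * (‖a i‖ * ‖a i‖) := mul_nonneg hγ h0
        simp only [Complex.coe_algebraMap, Complex.ofReal_one, one_pow, norm_one, mul_one]
        nlinarith
      · have := mul_le_mul_of_nonneg_left (h2 i j hij) h0
        linarith
    have e4 : (∑ i, ‖a i‖) ^ 2 ≤ Fintype.card κ * S := by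
      have := sq_sum_le_card_mul_sum_sq (s := Finset.univ) (f := fun i => ‖a i‖)
      simpa using this
    calc ‖y‖ ^ 2 ≤ ∑ i, ∑ j, ‖conj (a i) * a j * inner ℂ (φ i) (φ j)‖ := by
          rw [e2, e1]
          exact (norm_sum_le _ _).trans (Finset.sum_le_sum fun i _ => norm_sum_le _ _)
      _ ≤ ∑ i, ∑ j, ((if i = j then ‖a i‖ ^ 2 else 0) + γ * (‖a i‖ * ‖a j‖)) :=
          Finset.sum_le_sum fun i _ => Finset.sum_le_sum fun j _ => e3 i j
      _ = S + γ * (∑ i, ‖a i‖) ^ 2 := by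
          simp only [Finset.sum_add_distrib, Finset.sum_ite_eq, Finset.mem_univ, if_true,
            ← Finset.mul_sum, sq (∑ i, ‖a i‖), Finset.sum_mul, hS]
      _ ≤ (1 + Fintype.card κ * γ) * S := by nlinarith
  have hle : S ≤ ‖y‖ * ‖x‖ := by
    have := norm_inner_le_norm (𝕜 := ℂ) y x
    rwa [hyx, Complex.norm_real, Real.norm_of_nonneg hS0] at this
  rcases hS0.eq_or_lt with h0 | h0
  · rw [← h0]; positivity
  · have : S * S ≤ S * ((1 + Fintype.card κ * γ) * ‖x‖ ^ 2) := by
      calc S * S ≤ (‖y‖ * ‖x‖) * (‖y‖ * ‖x‖) := by gcongr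
        _ = ‖y‖ ^ 2 * ‖x‖ ^ 2 := by ring
        _ ≤ ((1 + Fintype.card κ * γ) * S) * ‖x‖ ^ 2 := by gcongr
        _ = _ := by ring
    exact le_of_mul_le_mul_left this h0

lemma norm_tr_le_of_isPositive [FiniteDimensional ℂ E] {ρ : Op E} (hρ : 0 ≤ ρ) :
    ‖tr ρ‖ ≤ (tr ρ).re := by
  have h := (ContinuousLinearMap.nonneg_iff_isPositive ρ).1 hρ
  obtain ⟨n, u, rfl⟩ := (ContinuousLinearMap.isPositive_iff_eq_sum_rankOne).1 h
  have : tr (∑ i, rankOne ℂ (u i) (u i)) = ((∑ i, ‖u i‖ ^ 2 : ℝ) : ℂ) := by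
    simp [tr, InnerProductSpace.trace_rankOne, inner_self_eq_norm_sq_to_K]
  rw [this, Complex.norm_real, Complex.ofReal_re, Real.norm_of_nonneg]
  positivity

/-- The total overlap of a positive operator with an almost orthonormal family is almost bounded by
its trace. -/
lemma sum_inner_apply_le_tr [FiniteDimensional ℂ E] {κ : Type*} [Fintype κ] {γ : ℝ} (hγ : 0 ≤ γ)
    {φ : κ → E} (h1 : ∀ j, ‖φ j‖ = 1) (h2 : ∀ i j, i ≠ j → ‖inner ℂ (φ i) (φ j)‖ ≤ γ)
    {ρ : Op E} (hρ : 0 ≤ ρ) :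
    ∑ j, ‖inner ℂ (φ j) (ρ (φ j))‖ ≤ (1 + Fintype.card κ * γ) * (tr ρ).re := by
  have h := (ContinuousLinearMap.nonneg_iff_isPositive ρ).1 hρ
  obtain ⟨n, u, rfl⟩ := (ContinuousLinearMap.isPositive_iff_eq_sum_rankOne).1 h
  have e1 : (tr (∑ i, rankOne ℂ (u i) (u i))).re = ∑ i, ‖u i‖ ^ 2 := by
    simp [tr, InnerProductSpace.trace_rankOne, inner_self_eq_norm_sq_to_K, ← Complex.ofReal_pow]
  have e2 : ∀ j, ‖inner ℂ (φ j) ((∑ i, rankOne ℂ (u i) (u i)) (φ j))‖ ≤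
      ∑ i, ‖inner ℂ (φ j) (u i)‖ ^ 2 := by
    intro j
    simp only [sum_apply, InnerProductSpace.rankOne_apply, inner_sum,
      inner_smul_right]
    refine (norm_sum_le _ _).trans (Finset.sum_le_sum fun i _ => ?_)
    rw [norm_mul, norm_inner_symm, sq]
  rw [e1, Finset.mul_sum]
  calc _ ≤ ∑ j, ∑ i, ‖inner ℂ (φ j) (u i)‖ ^ 2 := Finset.sum_le_sum fun j _ => e2 j
    _ = ∑ i, ∑ j, ‖inner ℂ (φ j) (u i)‖ ^ 2 := Finset.sum_comm
    _ ≤ _ := Finset.sum_le_sum fun i _ => sum_norm_inner_sq_le hγ h1 h2 _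

lemma norm_inner_apply_le_tr [FiniteDimensional ℂ E] {φ : E} (hφ : ‖φ‖ = 1) {ρ : Op E}
    (hρ : 0 ≤ ρ) : ‖inner ℂ φ (ρ φ)‖ ≤ (tr ρ).re := by
  have := sum_inner_apply_le_tr (κ := Unit) le_rfl (φ := fun _ => φ) (fun _ => hφ)
    (fun i j h => absurd (Subsingleton.elim i j) h) hρ
  simpa using this

lemma tr_dyad_re [FiniteDimensional ℂ E] (v : E) : (tr (dyad v)).re = ‖v‖ ^ 2 := by
  simp [tr, dyad, InnerProductSpace.trace_rankOne, inner_self_eq_norm_sq_to_K,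
    ← Complex.ofReal_pow]

lemma dyad_nonneg (v : E) : 0 ≤ dyad v :=
  (ContinuousLinearMap.nonneg_iff_isPositive _).2 (InnerProductSpace.isPositive_rankOne_self v)

lemma dyad_smul (c : ℂ) (hc : ‖c‖ = 1) (v : E) : dyad (c • v) = dyad v := by
  ext x
  simp only [dyad, InnerProductSpace.rankOne_apply, inner_smul_left, smul_smul]
  rw [mul_right_comm, Complex.conj_mul', hc]
  simp

/-- Polarization: a functional dominated by the trace on positive operators is bounded on
rank-one operators. -/
lemma norm_apply_rankOne_le [FiniteDimensional ℂ E] (l : Op E →ₗ[ℂ] ℂ)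
    (hl : ∀ ρ, 0 ≤ ρ → ‖l ρ‖ ≤ (tr ρ).re) (v w : E) :
    ‖l (rankOne ℂ v w)‖ ≤ (‖v‖ + ‖w‖) ^ 2 := by
  have key : (4 : ℂ) • rankOne ℂ v w = dyad (v + w) - dyad (v - w)
      + Complex.I • dyad (v + Complex.I • w) - Complex.I • dyad (v - Complex.I • w) := by
    ext x
    simp only [dyad, map_add, map_sub, map_smul, map_smulₛₗ, add_apply,
      sub_apply, smul_apply, Complex.conj_I]
    simp only [smul_add, smul_sub, smul_smul, neg_smul, Complex.I_mul_I, neg_neg,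
      smul_neg, one_smul]
    module
  have hb : ∀ c : ℂ, ‖c‖ = 1 → ‖l (dyad (v + c • w))‖ ≤ (‖v‖ + ‖w‖) ^ 2 := by
    intro c hc
    refine (hl _ (dyad_nonneg _)).trans ?_
    rw [tr_dyad_re]
    gcongr
    exact (norm_add_le _ _).trans (by rw [norm_smul, hc, one_mul])
  have h1 := hb 1 (by simp)
  have h2 := hb (-1) (by simp)
  have h3 := hb Complex.I (by simp)
  have h4 := hb (-Complex.I) (by simp)
  simp only [one_smul, neg_smul, ← sub_eq_add_neg] at h1 h2 h3 h4
  have hk : (4 : ℂ) * l (rankOne ℂ v w) = l (dyad (v + w)) - l (dyad (v - w))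
      + Complex.I * l (dyad (v + Complex.I • w)) - Complex.I * l (dyad (v - Complex.I • w)) := by
    have := congrArg l key
    simpa only [map_add, map_sub, map_smul, smul_eq_mul] using this
  have h5 : ‖(4 : ℂ) * l (rankOne ℂ v w)‖ ≤ 4 * (‖v‖ + ‖w‖) ^ 2 := by
    rw [hk]
    have a1 := norm_sub_le (l (dyad (v + w)) - l (dyad (v - w))
      + Complex.I * l (dyad (v + Complex.I • w))) (Complex.I * l (dyad (v - Complex.I • w)))
    have a2 := norm_add_le (l (dyad (v + w)) - l (dyad (v - w)))
      (Complex.I * l (dyad (v + Complex.I • w)))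
    have a3 := norm_sub_le (l (dyad (v + w))) (l (dyad (v - w)))
    simp only [norm_mul, Complex.norm_I, one_mul] at a1 a2 a3
    linarith
  rw [norm_mul, Complex.norm_ofNat] at h5
  linarith

end LinearAlgebra

/-! ### Overlaps and norms of tensor powers. -/

section TensorPower

variable {ι : Type*}

lemma inner_tensorPow [Fintype ι] (N : ℕ) (φ χ : Sys ι) :
    inner ℂ (tensorPow N φ) (tensorPow N χ) = inner ℂ φ χ ^ N := by
  classical
  simp only [tensorPow, PiLp.inner_apply, RCLike.inner_apply, map_prod]
  rw [← Fin.prod_const, Finset.prod_univ_sum, Fintype.piFinset_univ]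
  simp only [Finset.prod_mul_distrib]

lemma norm_tensorPow [Fintype ι] (N : ℕ) (φ : Sys ι) : ‖tensorPow N φ‖ = ‖φ‖ ^ N := by
  have h := inner_tensorPow N φ φ
  rw [inner_self_eq_norm_sq_to_K, inner_self_eq_norm_sq_to_K, pow_right_comm] at h
  have h' : ‖tensorPow N φ‖ ^ 2 = (‖φ‖ ^ N) ^ 2 := by exact_mod_cast h
  exact (sq_eq_sq₀ (norm_nonneg _) (by positivity)).1 h'

lemma tensorPow_smul (N : ℕ) (c : ℂ) (φ : Sys ι) :
    tensorPow N (c • φ) = c ^ N • tensorPow N φ := by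
  ext f
  simp [tensorPow, Finset.prod_mul_distrib]

end TensorPower

/-! ### Complex analysis: growth on a strip controls the slope on the real line. -/

/-- A Bernstein-type inequality: an entire function that is bounded by `A` on the real line and by
`A * exp L` on a strip of half-width `Y` is Lipschitz on the real line. -/
lemma norm_sub_le_of_bounded_on_strip {g : ℂ → ℂ} (hg : Differentiable ℂ g) {A L Y : ℝ}
    (hA : 0 < A) (hY : 0 < Y) (hL : 1 ≤ L) (hreal : ∀ x : ℝ, ‖g x‖ ≤ A)
    (hstrip : ∀ z : ℂ, |z.im| ≤ Y → ‖g z‖ ≤ A * Real.exp L) (x x' : ℝ) :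
    ‖g x - g x'‖ ≤ Real.exp 1 * A * L / Y * |x - x'| := by
  have hL0 : 0 < L := one_pos.trans_le hL
  have upper : ∀ f : ℂ → ℂ, Differentiable ℂ f → (∀ x : ℝ, ‖f x‖ ≤ A) →
      (∀ z : ℂ, |z.im| ≤ Y → ‖f z‖ ≤ A * Real.exp L) → ∀ z : ℂ, 0 ≤ z.im → z.im ≤ Y / L →
      ‖f z‖ ≤ Real.exp 1 * A := by
    intro f hf hfr hfs z h0 h1
    have hYL : Y / L ≤ Y := div_le_self hY.le hL
    -- Interpolation at height `θ Y` gives `A exp(θ L)`, and `θ ≤ 1 / L` makes this at most `e A`.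
    -- The factor `Complex.I` turns the horizontal strip into a vertical one.
    have key := Complex.HadamardThreeLines.norm_le_interp_of_mem_verticalClosedStrip'
      (f := fun w => f (Complex.I * w)) (z := -Complex.I * z) (a := A) (b := A * Real.exp L)
      (l := 0) (u := Y) hY ?_ ?_ ?_ ?_ ?_
    · have hz : Complex.I * (-Complex.I * z) = z := by
        rw [← mul_assoc]; simp
      have hre : (-Complex.I * z).re = z.im := by simp
      simp only [hz, hre, sub_zero] at key
      refine key.trans ?_
      rw [Real.mul_rpow hA.le (Real.exp_pos _).le, ← mul_assoc, ← Real.rpow_add hA,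
        sub_add_cancel, Real.rpow_one, ← Real.exp_mul, mul_comm]
      gcongr
      rw [le_div_iff₀ hL0] at h1
      rw [← mul_div_assoc, div_le_one hY]
      linarith
    · constructor
      · simpa using h0
      · simpa using h1.trans hYL
    · exact (hf.comp (differentiable_id.const_mul _)).diffContOnCl
    · refine ⟨A * Real.exp L, ?_⟩
      rintro _ ⟨w, hw, rfl⟩
      refine hfs _ ?_
      have h2 := hw.1
      have h3 := hw.2
      simpa [abs_of_nonneg h2] using h3
    · intro w hw
      have hw' : w.re = 0 := hw
      have : Complex.I * w = ((-w.im : ℝ) : ℂ) := by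
        apply Complex.ext <;> simp [hw']
      simp only [this]
      exact hfr _
    · intro w hw
      have hw' : w.re = Y := hw
      refine hfs _ ?_
      simp [hw', abs_of_pos hY]
  have strip : ∀ z : ℂ, |z.im| ≤ Y / L → ‖g z‖ ≤ Real.exp 1 * A := by
    intro z hz
    rcases le_total 0 z.im with h | h
    · exact upper g hg hreal hstrip z h (by rwa [abs_of_nonneg h] at hz)
    · have := upper (fun w => g (-w)) (hg.comp differentiable_neg)
        (fun x => by simpa using hreal (-x)) (fun w hw => hstrip _ (by simpa using hw)) (-z)
        (by simpa using h) (by rw [abs_of_nonpos h] at hz; simpa using hz)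
      simpa using this
  have hYL0 : 0 < Y / L := div_pos hY hL0
  -- Cauchy's estimate on the circle of radius `Y / L`, which stays in the thin strip.
  have hderiv : ∀ x : ℝ, ‖deriv g x‖ ≤ Real.exp 1 * A * L / Y := by
    intro x
    have := Complex.norm_deriv_le_of_forall_mem_sphere_norm_le (f := g) (c := (x : ℂ)) hYL0
      (C := Real.exp 1 * A) hg.diffContOnCl ?_
    · rwa [div_div_eq_mul_div] at this
    · intro z hz
      refine strip z ?_
      have h1 : (z - x).im = z.im := by simp
      rw [← h1]
      exact (Complex.abs_im_le_norm _).trans (by rw [← dist_eq_norm]; exact hz.le)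
  have hd : ∀ y : ℝ, HasDerivAt (fun y : ℝ => g y) (deriv g y) y := fun y =>
    (hg y).hasDerivAt.comp_ofReal
  have := convex_univ.norm_image_sub_le_of_norm_hasDerivWithin_le
    (f := fun y : ℝ => g y) (f' := fun y : ℝ => deriv g y) (s := Set.univ)
    (fun y _ => (hd y).hasDerivWithinAt) (fun y _ => hderiv y) (Set.mem_univ x') (Set.mem_univ x)
  simpa using this

/-! ### Growth in imaginary time and loss of overlap in real time. -/

section Exponential

lemma norm_exp_sub_partialSum_le {𝔸 : Type*} [NormedRing 𝔸] [NormOneClass 𝔸]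
    [NormedAlgebra ℂ 𝔸] [CompleteSpace 𝔸] (a : 𝔸) {n : ℕ} (hn : 0 < n) (ha : ‖a‖ ≤ 1) :
    ‖NormedSpace.exp a - ∑ k ∈ Finset.range n, ((k.factorial : ℂ)⁻¹) • a ^ k‖ ≤ ‖a‖ ^ n * 2 := by
  have h1 : HasSum (fun k : ℕ => ((k.factorial : ℂ)⁻¹) • a ^ k) (NormedSpace.exp a) :=
    NormedSpace.exp_series_hasSum_exp' (𝕂 := ℂ) a
  have h2 : HasSum (fun k : ℕ => ‖a‖ ^ k / (k.factorial : ℝ)) (Real.exp ‖a‖) := by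
    rw [Real.exp_eq_exp_ℝ]
    exact NormedSpace.expSeries_div_hasSum_exp ‖a‖
  have h1' := (hasSum_nat_add_iff' n).2 h1
  have h2' := (hasSum_nat_add_iff' n).2 h2
  have h3 := h1'.norm_le_of_bounded h2' (fun k => by
    rw [norm_smul, norm_inv, Complex.norm_natCast, div_eq_inv_mul]
    gcongr
    exact norm_pow_le _ _)
  refine h3.trans ((le_abs_self _).trans ?_)
  have h4 := Real.exp_bound (x := ‖a‖) (by rwa [abs_norm]) hn
  rw [abs_norm] at h4
  refine h4.trans ?_
  gcongr
  have hn' : (1 : ℝ) ≤ n := by exact_mod_cast hn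
  have hf : (1 : ℝ) ≤ n.factorial := by exact_mod_cast n.factorial_pos
  rw [div_le_iff₀ (by positivity)]
  push_cast
  nlinarith

variable {E : Type*} [NormedAddCommGroup E] [InnerProductSpace ℂ E] [CompleteSpace E]

lemma exp_add_smul (T : Op E) (a b : ℂ) :
    NormedSpace.exp ((a + b) • T) = NormedSpace.exp (a • T) * NormedSpace.exp (b • T) := by
  let : NormedAlgebra ℚ (Op E) := .restrictScalars ℚ ℂ (Op E)
  rw [add_smul]
  exact NormedSpace.exp_add_of_commute (((Commute.refl T).smul_left a).smul_right b)

lemma exp_mem_unitary {T : Op E} (hT : IsSelfAdjoint T) (t : ℝ) :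
    NormedSpace.exp ((-(Complex.I * (t : ℂ))) • T) ∈ unitary (Op E) := by
  let : NormedAlgebra ℚ (Op E) := .restrictScalars ℚ ℂ (Op E)
  apply NormedSpace.exp_mem_unitary_of_mem_skewAdjoint
  rw [skewAdjoint.mem_iff, star_smul, hT.star_eq]
  simp

lemma norm_exp_apply {T : Op E} (hT : IsSelfAdjoint T) (t : ℝ) (v : E) :
    ‖NormedSpace.exp ((-(Complex.I * (t : ℂ))) • T) v‖ = ‖v‖ :=
  ContinuousLinearMap.norm_map_of_mem_unitary (exp_mem_unitary hT t) v

/-- Real time acts unitarily, so only `y = z.im` matters. Since `Tψ ⊥ ψ`, the first-order term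
changes the norm only at order `y²`. The `N`-th power therefore stays bounded up to `y` of order
`N^(-1/2)`, where a linear exponent would allow only `1 / N`. -/
lemma norm_exp_smul_apply_le [Nontrivial E] {T : Op E} (hT : IsSelfAdjoint T) {ψ : E}
    (hψ : ‖ψ‖ = 1) (h0 : inner ℂ ψ (T ψ) = 0) {R : ℝ} (hR : ‖T‖ ≤ R) {z : ℂ}
    (hz : |z.im| * R ≤ 1) :
    ‖NormedSpace.exp ((-(Complex.I * z)) • T) ψ‖ ≤ Real.exp (3 * (|z.im| * R) ^ 2) := by
  have hsplit : -(Complex.I * z) = -(Complex.I * (z.re : ℂ)) + (z.im : ℂ) := by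
    apply Complex.ext <;> simp
  rw [hsplit, exp_add_smul, mul_apply_eq_comp, norm_exp_apply hT]
  set A : Op E := (z.im : ℂ) • T with hA
  have hAR : ‖A‖ ≤ |z.im| * R := by
    rw [hA, norm_smul, Complex.norm_real, Real.norm_eq_abs]
    gcongr
  have hA1 : ‖A‖ ≤ 1 := hAR.trans hz
  have h2 := norm_exp_sub_partialSum_le A two_pos hA1
  have h3 : ‖NormedSpace.exp A ψ - (ψ + A ψ)‖ ≤ ‖A‖ ^ 2 * 2 := by
    have := ContinuousLinearMap.le_opNorm
      (NormedSpace.exp A - ∑ k ∈ Finset.range 2, ((k.factorial : ℂ)⁻¹) • A ^ k) ψ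
    rw [hψ, mul_one] at this
    refine le_trans (le_of_eq ?_) (this.trans h2)
    simp [Finset.sum_range_succ]
  have h4 : ‖ψ + A ψ‖ ^ 2 ≤ (1 + ‖A‖ ^ 2) ^ 2 := by
    have hz0 : inner ℂ ψ (A ψ) = 0 := by simp [hA, h0]
    have h5 : ‖A ψ‖ ≤ ‖A‖ := by simpa [hψ] using A.le_opNorm ψ
    have h6 := norm_add_mul_self (𝕜 := ℂ) ψ (A ψ)
    rw [hz0, hψ] at h6
    simp only [map_zero, mul_zero] at h6
    nlinarith [norm_nonneg (A ψ), sq_nonneg (‖A‖ ^ 2)]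
  have h7 : ‖ψ + A ψ‖ ≤ 1 + ‖A‖ ^ 2 := (sq_le_sq₀ (norm_nonneg _) (by positivity)).1 h4
  have h8 := norm_le_norm_add_norm_sub' (NormedSpace.exp A ψ) (ψ + A ψ)
  calc ‖NormedSpace.exp A ψ‖ ≤ 3 * ‖A‖ ^ 2 + 1 := by linarith
    _ ≤ 3 * (|z.im| * R) ^ 2 + 1 := by gcongr
    _ ≤ _ := Real.add_one_le_exp _

lemma inner_exp_apply_exp_apply {T : Op E} (hT : IsSelfAdjoint T) (ψ : E) (a b : ℝ) :
    inner ℂ (NormedSpace.exp ((-(Complex.I * (a : ℂ))) • T) ψ)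
      (NormedSpace.exp ((-(Complex.I * (b : ℂ))) • T) ψ) =
    inner ℂ ψ (NormedSpace.exp ((-(Complex.I * ((b - a : ℝ) : ℂ))) • T) ψ) := by
  have hsplit : -(Complex.I * (b : ℂ)) = -(Complex.I * (a : ℂ)) +
      -(Complex.I * ((b - a : ℝ) : ℂ)) := by push_cast; ring
  rw [hsplit, exp_add_smul, mul_apply_eq_comp]
  exact ContinuousLinearMap.inner_map_map_of_mem_unitary (exp_mem_unitary hT a) _ _

/-- The overlap of a vector with its time evolution decays quadratically for short times. -/
lemma norm_inner_exp_le [Nontrivial E] {T : Op E} (hT : IsSelfAdjoint T) {ψ : E}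
    (hψ : ‖ψ‖ = 1) (h0 : inner ℂ ψ (T ψ) = 0) {R : ℝ} (hR : ‖T‖ ≤ R) {s : ℝ}
    (hs : |s| * R ≤ 1) (hs' : 2 * R ^ 3 * |s| ≤ ‖T ψ‖ ^ 2 / 4) :
    ‖inner ℂ ψ (NormedSpace.exp ((-(Complex.I * (s : ℂ))) • T) ψ)‖ ≤
      Real.exp (-(‖T ψ‖ ^ 2 / 4 * s ^ 2)) := by
  set A : Op E := (-(Complex.I * (s : ℂ))) • T with hA
  have hAR : ‖A‖ ≤ |s| * R := by
    rw [hA, norm_smul]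
    simp only [norm_neg, norm_mul, Complex.norm_I, one_mul, Complex.norm_real, Real.norm_eq_abs]
    gcongr
  have h3 := norm_exp_sub_partialSum_le A three_pos (hAR.trans hs)
  set r : Op E := NormedSpace.exp A - ∑ k ∈ Finset.range 3, ((k.factorial : ℂ)⁻¹) • A ^ k with hr
  have hexp : NormedSpace.exp A ψ = ψ + A ψ + (2 : ℂ)⁻¹ • A (A ψ) + r ψ := by
    simp [hr, Finset.sum_range_succ, Nat.factorial, pow_two]
  have h1 : inner ℂ ψ (A ψ) = 0 := by simp [hA, inner_smul_right, h0]
  have h2 : inner ℂ ψ (A (A ψ)) = -((s ^ 2 * ‖T ψ‖ ^ 2 : ℝ) : ℂ) := by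
    have e : inner ℂ ψ (T (T ψ)) = ((‖T ψ‖ ^ 2 : ℝ) : ℂ) := by
      have := ContinuousLinearMap.adjoint_inner_left T (T ψ) ψ
      rw [hT.adjoint_eq] at this
      rw [← this, inner_self_eq_norm_sq_to_K]
      simp
    simp only [hA, smul_apply, map_smul, inner_smul_right, e]
    push_cast
    linear_combination (s ^ 2 * ‖T ψ‖ ^ 2 : ℂ) * Complex.I_sq
  have hσ : ‖T ψ‖ ≤ R := by
    have := T.le_opNorm ψ
    rw [hψ, mul_one] at this
    exact this.trans hR
  have hin : inner ℂ ψ (NormedSpace.exp A ψ) =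
      ((1 - s ^ 2 * ‖T ψ‖ ^ 2 / 2 : ℝ) : ℂ) + inner ℂ ψ (r ψ) := by
    rw [hexp, inner_add_right, inner_add_right, inner_add_right, h1, inner_smul_right, h2,
      inner_self_eq_norm_sq_to_K, hψ]
    push_cast
    ring
  have hrψ : ‖inner ℂ ψ (r ψ)‖ ≤ (|s| * R) ^ 3 * 2 := by
    refine (norm_inner_le_norm _ _).trans ?_
    rw [hψ, one_mul]
    have := r.le_opNorm ψ
    rw [hψ, mul_one] at this
    refine this.trans (h3.trans ?_)
    gcongr
  have hpos : 0 ≤ 1 - s ^ 2 * ‖T ψ‖ ^ 2 / 2 := by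
    have : |s| * ‖T ψ‖ ≤ 1 := (by gcongr : |s| * ‖T ψ‖ ≤ |s| * R).trans hs
    have h' : (|s| * ‖T ψ‖) ^ 2 ≤ 1 := pow_le_one₀ (by positivity) this
    rw [mul_pow, sq_abs] at h'
    linarith
  -- The cubic remainder uses up half of the decay `s² ‖Tψ‖² / 2`, which leaves the `1 / 4` in the
  -- exponent.
  have hcube : (|s| * R) ^ 3 * 2 ≤ ‖T ψ‖ ^ 2 / 4 * s ^ 2 := by
    calc (|s| * R) ^ 3 * 2 = (2 * R ^ 3 * |s|) * |s| ^ 2 := by ring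
      _ ≤ (‖T ψ‖ ^ 2 / 4) * |s| ^ 2 := by gcongr
      _ = _ := by rw [sq_abs]
  rw [hin]
  refine (norm_add_le _ _).trans ?_
  rw [Complex.norm_real, Real.norm_of_nonneg hpos]
  have := Real.add_one_le_exp (-(‖T ψ‖ ^ 2 / 4 * s ^ 2))
  linarith

end Exponential

/-! ### Analytic continuation in time and the Lipschitz bound. -/

variable {ι : Type*} [Fintype ι]

/-- The second slot of `rankOne` is conjugate-linear; evaluating `u` there at `conj z` conjugates
twice and restores holomorphy. At real `z` the operator is the dyad of `u z`. -/
lemma differentiable_rankOne_tensorPow {N : ℕ} (l : Op (Copies ι N) →ₗ[ℂ] ℂ) {u : ℂ → Sys ι}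
    (hu : Differentiable ℂ u) :
    Differentiable ℂ fun z =>
      l (rankOne ℂ (tensorPow N (u z)) (tensorPow N (u (conj z)))) := by
  classical
  let e := EuclideanSpace.basisFun (Fin N → ι) ℂ
  have hexp : ∀ v w : Copies ι N,
      l (rankOne ℂ v w) = ∑ g, ∑ f, conj (w g) * (v f * l (rankOne ℂ (e f) (e g))) := by
    intro v w
    have hv : v = ∑ f, v f • e f := by simpa [e] using (e.sum_repr v).symm
    have hw : w = ∑ g, w g • e g := by simpa [e] using (e.sum_repr w).symm
    conv_lhs => rw [hv, hw]
    simp only [map_sum, map_smul, map_smulₛₗ, sum_apply, smul_apply, smul_eq_mul,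
      Finset.mul_sum]
  rw [funext fun z => hexp (tensorPow N (u z)) (tensorPow N (u (conj z)))]
  have hcoord : ∀ i, Differentiable ℂ fun z => u z i := fun i =>
    (EuclideanSpace.proj (𝕜 := ℂ) i : Sys ι →L[ℂ] ℂ).differentiable.comp hu
  have hcomp : ∀ f : Fin N → ι, Differentiable ℂ fun z => tensorPow N (u z) f := by
    intro f
    simp only [tensorPow]
    exact Differentiable.fun_finsetProd fun i _ => hcoord (f i)
  refine Differentiable.fun_sum fun g _ => Differentiable.fun_sum fun f _ => ?_
  refine Differentiable.mul (fun z => ?_) ((hcomp f).mul_const _)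
  have := DifferentiableAt.conj_conj (hcomp g (conj z))
  rw [Complex.conj_conj] at this
  exact this

lemma differentiable_exp_smul_apply (T : Op (Sys ι)) (ψ : Sys ι) :
    Differentiable ℂ fun z : ℂ => NormedSpace.exp ((-(Complex.I * z)) • T) ψ := by
  have h1 : Differentiable ℂ fun z : ℂ => NormedSpace.exp (z • T) := fun z =>
    (hasDerivAt_exp_smul_const T z).differentiableAt
  have h2 : Differentiable ℂ fun z : ℂ => -(Complex.I * z) :=
    (differentiable_id.const_mul _).neg
  exact (h1.comp h2).clm_apply (differentiable_const ψ)

lemma norm_clockState {T : Op (Sys ι)} (hT : IsSelfAdjoint T) {ψ : Sys ι} (hψ : ‖ψ‖ = 1)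
    (t : ℝ) : ‖clockState T ψ t‖ = 1 := by
  rw [clockState, norm_exp_apply hT, hψ]

lemma norm_tensorPow_clockState {T : Op (Sys ι)} (hT : IsSelfAdjoint T) {ψ : Sys ι}
    (hψ : ‖ψ‖ = 1) (N : ℕ) (t : ℝ) : ‖tensorPow N (clockState T ψ t)‖ = 1 := by
  rw [norm_tensorPow, norm_clockState hT hψ, one_pow]

/-- The Lipschitz constant scales with the real-line bound `A`, so a rare success costs only the
factor `L`, which is logarithmic in `1 / A`. On the strip, polarization and the growth of `ψ` give
the left side of `hB`. -/
lemma apply_dyad_clockState_lipschitz {N : ℕ} {T : Op (Sys ι)} (hT : IsSelfAdjoint T)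
    {ψ : Sys ι} (hψ : ‖ψ‖ = 1) (h0 : inner ℂ ψ (T ψ) = 0) {R A L Y : ℝ}
    (hR : ‖T‖ ≤ R)
    (l : Op (Copies ι N) →ₗ[ℂ] ℂ) (hl : ∀ ρ, 0 ≤ ρ → ‖l ρ‖ ≤ (tr ρ).re)
    (hA : 0 < A) (hY : 0 < Y) (hYR : Y * R ≤ 1) (hL : 1 ≤ L)
    (hreal : ∀ t : ℝ, ‖l (dyad (tensorPow N (clockState T ψ t)))‖ ≤ A)
    (hB : 4 * Real.exp (6 * (N * (Y * R) ^ 2)) ≤ A * Real.exp L) (t t' : ℝ) :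
    ‖l (dyad (tensorPow N (clockState T ψ t))) - l (dyad (tensorPow N (clockState T ψ t')))‖ ≤
      Real.exp 1 * A * L / Y * |t - t'| := by
  have : Nontrivial (Sys ι) := ⟨ψ, 0, fun h => by simp [h] at hψ⟩
  have hR0 : 0 ≤ R := (norm_nonneg T).trans hR
  set u : ℂ → Sys ι := fun z => NormedSpace.exp ((-(Complex.I * z)) • T) ψ with hu
  have hnorm : ∀ z : ℂ, |z.im| ≤ Y →
      ‖tensorPow N (u z)‖ ≤ Real.exp (3 * (N * (Y * R) ^ 2)) := by
    intro z hz
    have hzR : |z.im| * R ≤ Y * R := by gcongr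
    rw [norm_tensorPow]
    calc ‖u z‖ ^ N ≤ Real.exp (3 * (|z.im| * R) ^ 2) ^ N := by
          gcongr
          exact norm_exp_smul_apply_le hT hψ h0 hR (hzR.trans hYR)
      _ ≤ Real.exp (3 * (Y * R) ^ 2) ^ N := by gcongr
      _ = _ := by rw [← Real.exp_nat_mul]; ring_nf
  have hg := differentiable_rankOne_tensorPow l (differentiable_exp_smul_apply T ψ)
  have hgr : ∀ x : ℝ, l (rankOne ℂ (tensorPow N (u x)) (tensorPow N (u (conj (x : ℂ))))) =
      l (dyad (tensorPow N (clockState T ψ x))) := by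
    intro x
    rw [Complex.conj_ofReal]
    rfl
  have := norm_sub_le_of_bounded_on_strip hg hA hY hL (fun x => by
    change ‖l (rankOne ℂ (tensorPow N (u x)) (tensorPow N (u (conj (x : ℂ)))))‖ ≤ A
    rw [hgr]; exact hreal x) (fun z hz => by
      refine (norm_apply_rankOne_le l hl _ _).trans (le_trans ?_ hB)
      have h1 := hnorm z hz
      have h2 := hnorm (conj z) (by simpa using hz)
      calc _ ≤ (Real.exp (3 * (N * (Y * R) ^ 2)) + Real.exp (3 * (N * (Y * R) ^ 2))) ^ 2 := by
            gcongr
        _ = 4 * Real.exp (6 * (N * (Y * R) ^ 2)) := by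
            rw [← two_mul, mul_pow, ← Real.exp_nat_mul]
            push_cast
            ring_nf) t t'
  change ‖l (rankOne ℂ (tensorPow N (u t)) (tensorPow N (u (conj (t : ℂ))))) -
    l (rankOne ℂ (tensorPow N (u t')) (tensorPow N (u (conj (t' : ℂ)))))‖ ≤ _ at this
  rwa [hgr, hgr] at this

/-! ### The fidelity bound at fixed `N`. -/

section Fidelity

variable {N M : ℕ} {T : Op (Sys ι)} {ψ : Sys ι} (P : ReplicationProcess ι N M)

lemma toCP_nonneg {ρ : Op (Copies ι N)} (hρ : 0 ≤ ρ) : 0 ≤ P.toCP ρ :=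
  map_nonneg P.toCP hρ

/-- The trace as a linear functional on operators. -/
noncomputable def trLinear (E : Type*) [NormedAddCommGroup E] [InnerProductSpace ℂ E] :
    Op E →ₗ[ℂ] ℂ :=
  (LinearMap.trace ℂ E).comp (ContinuousLinearMap.coeLM ℂ)

/-- The expectation value in the state `φ` as a linear functional on operators. -/
noncomputable def expectation {E : Type*} [NormedAddCommGroup E] [InnerProductSpace ℂ E]
    (φ : E) : Op E →ₗ[ℂ] ℂ :=
  (innerSL ℂ φ).toLinearMap.comp (ContinuousLinearMap.apply ℂ E φ).toLinearMap

lemma successProbAt_nonneg (t : ℝ) : 0 ≤ successProbAt T ψ P t :=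
  (norm_nonneg _).trans (norm_tr_le_of_isPositive (toCP_nonneg P (dyad_nonneg _)))

lemma successProbAt_le_one (hT : IsSelfAdjoint T) (hψ : ‖ψ‖ = 1) (t : ℝ) :
    successProbAt T ψ P t ≤ 1 := by
  have := P.trace_le _ (dyad_nonneg (tensorPow N (clockState T ψ t)))
  rwa [tr_dyad_re, norm_tensorPow_clockState hT hψ, one_pow] at this

lemma successProbAt_le_successProb (hT : IsSelfAdjoint T) (hψ : ‖ψ‖ = 1) (t : ℝ) :
    successProbAt T ψ P t ≤ successProb T ψ P :=
  le_ciSup (f := successProbAt T ψ P)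
    ⟨1, by rintro _ ⟨s, rfl⟩; exact successProbAt_le_one P hT hψ s⟩ t

lemma fidelityAt_nonneg (t : ℝ) : 0 ≤ fidelityAt T ψ P t := by
  refine div_nonneg ?_ (successProbAt_nonneg P t)
  have := (ContinuousLinearMap.nonneg_iff_isPositive _).1
    (toCP_nonneg P (dyad_nonneg (tensorPow N (clockState T ψ t))))
  exact this.re_inner_nonneg_right _

lemma worstFidelity_nonneg : 0 ≤ worstFidelity T ψ P :=
  Real.iInf_nonneg fun t => fidelityAt_nonneg P t

lemma worstFidelity_mul_le {t : ℝ} (ht : 0 < successProbAt T ψ P t) :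
    worstFidelity T ψ P * successProbAt T ψ P t ≤
      ‖inner ℂ (tensorPow M (clockState T ψ t))
        (P.toCP (dyad (tensorPow N (clockState T ψ t))) (tensorPow M (clockState T ψ t)))‖ := by
  have h1 : worstFidelity T ψ P ≤ fidelityAt T ψ P t :=
    ciInf_le (f := fun t : {t : ℝ // 0 < successProbAt T ψ P t} => fidelityAt T ψ P t)
      ⟨0, by rintro _ ⟨s, rfl⟩; exact fidelityAt_nonneg P s⟩ ⟨t, ht⟩
  rw [fidelityAt, le_div_iff₀ ht] at h1
  exact h1.trans (Complex.re_le_norm _)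

/-- A quantitative bound on the worst-case fidelity, from `J` clock times with spacing `τ`. -/
lemma mul_worstFidelity_le (hT : IsSelfAdjoint T) (hψ : ‖ψ‖ = 1) (h0 : inner ℂ ψ (T ψ) = 0)
    {R L Y τ γ : ℝ} (hR : ‖T‖ ≤ R) (hp : 0 < successProb T ψ P)
    (hY : 0 < Y) (hYR : Y * R ≤ 1) (hL : 1 ≤ L)
    (hB : 4 * Real.exp (6 * (N * (Y * R) ^ 2)) ≤ successProb T ψ P * Real.exp L)
    (J : ℕ) (hτ : 0 < τ) (hτR : J * τ * R ≤ 1) (hτR' : 2 * R ^ 3 * (J * τ) ≤ ‖T ψ‖ ^ 2 / 4)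
    (hγ : Real.exp (-(‖T ψ‖ ^ 2 / 4 * (M * τ ^ 2))) ≤ γ)
    (hK : Real.exp 1 * L / Y * (J * τ) ≤ 1 / 4) :
    J * worstFidelity T ψ P ≤
      4 * (1 + J * γ) + 4 * J * (Real.exp 1 * L / Y * (J * τ)) := by
  have : Nontrivial (Sys ι) := ⟨ψ, 0, fun h => by simp [h] at hψ⟩
  have hR0 : 0 ≤ R := (norm_nonneg T).trans hR
  set p := successProb T ψ P with hpdef
  set F := worstFidelity T ψ P with hF
  set κ := Real.exp 1 * L / Y * (J * τ) with hκ
  set v : ℝ → Copies ι N := fun t => tensorPow N (clockState T ψ t) with hv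
  set w : ℝ → Copies ι M := fun t => tensorPow M (clockState T ψ t) with hw
  have hw1 : ∀ t, ‖w t‖ = 1 := norm_tensorPow_clockState hT hψ M
  have hsp : ∀ t, (tr (P.toCP (dyad (v t)))).re ≤ p :=
    successProbAt_le_successProb P hT hψ
  -- Used twice: with the trace, to keep the success probability from dropping, and with
  -- expectations, to replace the output at `s j` by the one at `t₀`.
  have hlip : ∀ l : Op (Copies ι M) →ₗ[ℂ] ℂ, (∀ ρ, 0 ≤ ρ → ‖l ρ‖ ≤ (tr ρ).re) →
      ∀ t t', |t - t'| ≤ J * τ →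
      ‖l (P.toCP (dyad (v t))) - l (P.toCP (dyad (v t')))‖ ≤ κ * p := by
    intro l hl t t' htt
    have := apply_dyad_clockState_lipschitz hT hψ h0 hR (l.comp P.toCP.toLinearMap)
      (fun ρ hρ => (hl _ (toCP_nonneg P hρ)).trans (P.trace_le ρ hρ)) hp hY hYR hL
      (fun t => (hl _ (toCP_nonneg P (dyad_nonneg _))).trans (hsp t)) hB t t'
    refine this.trans ?_
    calc Real.exp 1 * p * L / Y * |t - t'| ≤ Real.exp 1 * p * L / Y * (J * τ) := by gcongr
      _ = κ * p := by rw [hκ]; ring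
  -- The supremum need not be attained. Starting above `p / 2` and losing at most `κ p ≤ p / 4`
  -- leaves `p / 4` at every `s j`.
  obtain ⟨t₀, ht₀⟩ := exists_lt_of_lt_ciSup (show p / 2 < ⨆ t, successProbAt T ψ P t from
    half_lt_self hp)
  set s : Fin J → ℝ := fun j => t₀ + j * τ with hs
  have hst : ∀ j, |s j - t₀| ≤ J * τ := by
    intro j
    simp only [hs, add_sub_cancel_left]
    rw [abs_of_nonneg (by positivity)]
    have : (j : ℝ) ≤ J := by exact_mod_cast j.2.le
    gcongr
  have hpj : ∀ j, p / 4 ≤ successProbAt T ψ P (s j) := by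
    intro j
    have h1 := hlip (trLinear _) (fun ρ hρ => norm_tr_le_of_isPositive hρ) (s j) t₀ (hst j)
    have h2 := (Complex.abs_re_le_norm _).trans h1
    rw [Complex.sub_re] at h2
    have h3 := (abs_le.1 h2).1
    change -(κ * p) ≤ successProbAt T ψ P (s j) - successProbAt T ψ P t₀ at h3
    nlinarith
  have hF0 : 0 ≤ F := worstFidelity_nonneg P
  -- All `J` overlaps now concern one and the same output, so the Bessel-type bound applies to their
  -- sum.
  have hj : ∀ j, F * (p / 4) ≤ ‖inner ℂ (w (s j)) (P.toCP (dyad (v t₀)) (w (s j)))‖ + κ * p := by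
    intro j
    have h1 := hlip (expectation (w (s j)))
      (fun ρ hρ => norm_inner_apply_le_tr (hw1 _) hρ) (s j) t₀ (hst j)
    have h2 := norm_le_norm_add_norm_sub' (expectation (w (s j)) (P.toCP (dyad (v (s j)))))
      (expectation (w (s j)) (P.toCP (dyad (v t₀))))
    have h3 : F * successProbAt T ψ P (s j) ≤ _ :=
      worstFidelity_mul_le P ((by positivity : 0 < p / 4).trans_le (hpj j))
    calc F * (p / 4) ≤ F * successProbAt T ψ P (s j) := by gcongr; exact hpj j
      _ ≤ _ := h3
      _ ≤ _ := h2.trans (by gcongr; exact le_rfl)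
  have hov : ∀ i j, i ≠ j → ‖inner ℂ (w (s i)) (w (s j))‖ ≤ γ := by
    intro i j hij
    refine le_trans ?_ hγ
    have hd : s j - s i = ((j : ℝ) - i) * τ := by simp only [hs]; ring
    have hi : (i : ℝ) + 1 ≤ J := by exact_mod_cast i.2
    have hj' : (j : ℝ) + 1 ≤ J := by exact_mod_cast j.2
    have hi0 : (0 : ℝ) ≤ i := by positivity
    have hj0 : (0 : ℝ) ≤ j := by positivity
    have habs : |s j - s i| ≤ J * τ := by
      rw [hd, abs_mul, abs_of_pos hτ]
      gcongr
      rw [abs_le]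
      constructor <;> linarith
    have hsq : τ ^ 2 ≤ (s j - s i) ^ 2 := by
      rw [hd, mul_pow]
      have hij' : ((j : ℤ) - (i : ℤ)) ≠ 0 := by
        intro h
        exact hij (Fin.ext (by omega))
      have h1 : (1 : ℤ) ≤ ((j : ℤ) - (i : ℤ)) ^ 2 := 
        Int.add_one_le_of_lt ((sq_nonneg _).lt_of_ne' (pow_ne_zero 2 hij'))
      have h2 : (1 : ℝ) ≤ ((j : ℝ) - i) ^ 2 := by exact_mod_cast h1
      nlinarith [sq_nonneg τ]
    simp only [hw]
    rw [inner_tensorPow, norm_pow, clockState, clockState, inner_exp_apply_exp_apply hT]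
    have h3 := norm_inner_exp_le hT hψ h0 hR (s := s j - s i)
      ((mul_le_mul_of_nonneg_right habs hR0).trans hτR)
      ((mul_le_mul_of_nonneg_left habs (by positivity)).trans hτR')
    calc _ ≤ Real.exp (-(‖T ψ‖ ^ 2 / 4 * (s j - s i) ^ 2)) ^ M := by gcongr
      _ ≤ Real.exp (-(‖T ψ‖ ^ 2 / 4 * τ ^ 2)) ^ M := by gcongr
      _ = _ := by rw [← Real.exp_nat_mul]; ring_nf
  have hγ0 : 0 ≤ γ := (Real.exp_pos _).le.trans hγ
  have hsum := sum_inner_apply_le_tr hγ0 (fun j => hw1 (s j)) hov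
    (toCP_nonneg P (dyad_nonneg (v t₀)))
  rw [Fintype.card_fin] at hsum
  have htot : (J : ℝ) * (F * (p / 4)) ≤ (1 + J * γ) * p + J * (κ * p) := by
    calc (J : ℝ) * (F * (p / 4)) = ∑ _j : Fin J, F * (p / 4) := by simp
      _ ≤ ∑ j : Fin J, (‖inner ℂ (w (s j)) (P.toCP (dyad (v t₀)) (w (s j)))‖ + κ * p) :=
          Finset.sum_le_sum fun j _ => hj j
      _ = (∑ j : Fin J, ‖inner ℂ (w (s j)) (P.toCP (dyad (v t₀)) (w (s j)))‖) + J * (κ * p) := by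
          simp [Finset.sum_add_distrib]
      _ ≤ _ := by
          have := hsp t₀
          gcongr
          exact hsum.trans (by gcongr)
  have : p * (J * F) ≤ p * (4 * (1 + J * γ) + 4 * J * κ) := by linarith
  exact le_of_mul_le_mul_left this hp

end Fidelity

/-! ### Invariance under a shift of the energy. -/

section EnergyShift

variable {N M : ℕ}

/-- A shift of the energy only changes the phase of the clock states. -/
lemma exists_clockState_eq_smul (H : Op (Sys ι)) (ψ : Sys ι) (μ t : ℝ) :
    ∃ c : ℂ, ‖c‖ = 1 ∧ clockState H ψ t = c • clockState (H - (μ : ℂ) • 1) ψ t := by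
  let : NormedAlgebra ℚ (Op (Sys ι)) := .restrictScalars ℚ ℂ (Op (Sys ι))
  refine ⟨Complex.exp (((-(t * μ) : ℝ) : ℂ) * Complex.I), Complex.norm_exp_ofReal_mul_I _, ?_⟩
  set a : ℂ := -(Complex.I * (t : ℂ)) with ha
  have h1 : a • H = algebraMap ℂ (Op (Sys ι)) (a * μ) + a • (H - (μ : ℂ) • 1) := by
    rw [Algebra.algebraMap_eq_smul_one]
    module
  have h2 : ((-(t * μ) : ℝ) : ℂ) * Complex.I = a * μ := by
    rw [ha]; push_cast; ring
  rw [clockState, clockState, ← ha, h1,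
    NormedSpace.exp_add_of_commute (Algebra.commutes (R := ℂ) (a * μ) (a • (H - (μ : ℂ) • 1))),
    ← NormedSpace.algebraMap_exp_comm, h2, Complex.exp_eq_exp_ℂ, Algebra.algebraMap_eq_smul_one,
    smul_mul_assoc, one_mul, smul_apply]

lemma dyad_tensorPow_smul (c : ℂ) (hc : ‖c‖ = 1) (φ : Sys ι) :
    dyad (tensorPow N (c • φ)) = dyad (tensorPow N φ) := by
  rw [tensorPow_smul, dyad_smul _ (by rw [norm_pow, hc, one_pow])]

lemma inner_smul_apply_smul {E : Type*} [NormedAddCommGroup E] [InnerProductSpace ℂ E] (c : ℂ)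
    (hc : ‖c‖ = 1) (φ : E) (A : Op E) : inner ℂ (c • φ) (A (c • φ)) = inner ℂ φ (A φ) := by
  rw [map_smul, inner_smul_left, inner_smul_right, ← mul_assoc, Complex.conj_mul', hc]
  simp

variable (H : Op (Sys ι)) (ψ : Sys ι) (μ : ℝ) (P : ReplicationProcess ι N M)

lemma successProbAt_sub_smul_one (t : ℝ) :
    successProbAt (H - (μ : ℂ) • 1) ψ P t = successProbAt H ψ P t := by
  obtain ⟨c, hc, h⟩ := exists_clockState_eq_smul H ψ μ t
  rw [successProbAt, successProbAt, h, dyad_tensorPow_smul c hc]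

lemma fidelityAt_sub_smul_one (t : ℝ) :
    fidelityAt (H - (μ : ℂ) • 1) ψ P t = fidelityAt H ψ P t := by
  rw [fidelityAt, fidelityAt, successProbAt_sub_smul_one]
  obtain ⟨c, hc, h⟩ := exists_clockState_eq_smul H ψ μ t
  rw [h, dyad_tensorPow_smul c hc, tensorPow_smul,
    inner_smul_apply_smul _ (by rw [norm_pow, hc, one_pow])]

lemma successProb_sub_smul_one :
    successProb (H - (μ : ℂ) • 1) ψ P = successProb H ψ P := by
  simp only [successProb, successProbAt_sub_smul_one]

lemma worstFidelity_sub_smul_one :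
    worstFidelity (H - (μ : ℂ) • 1) ψ P = worstFidelity H ψ P := by
  have h : successProbAt (H - (μ : ℂ) • 1) ψ P = successProbAt H ψ P :=
    funext (successProbAt_sub_smul_one H ψ μ P)
  simp only [worstFidelity, fidelityAt_sub_smul_one]
  rw [h]

end EnergyShift

/-! ### Choice of scales and the limit. -/

section Asymptotics

lemma tendsto_natCast_rpow_neg {b : ℝ} (hb : 0 < b) :
    Tendsto (fun N : ℕ => (N : ℝ) ^ (-b)) atTop (𝓝 0) :=
  (tendsto_rpow_neg_atTop hb).comp tendsto_natCast_atTop_atTop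

lemma tendsto_natCast_rpow {b : ℝ} (hb : 0 < b) :
    Tendsto (fun N : ℕ => (N : ℝ) ^ b) atTop atTop :=
  (tendsto_rpow_atTop hb).comp tendsto_natCast_atTop_atTop

lemma tendsto_worstFidelity_of_centered {T : Op (Sys ι)} (hT : IsSelfAdjoint T) {ψ : Sys ι}
    (hψ : ‖ψ‖ = 1) (h0 : inner ℂ ψ (T ψ) = 0) (hTψ : T ψ ≠ 0) {ε c δ q : ℝ} {M : ℕ → ℕ}
    (P : ∀ N : ℕ, ReplicationProcess ι N (M N)) (hδ0 : 0 ≤ δ) (hδ : δ < ε) (hε : ε ≤ 1)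
    (hc : 0 < c) (hq : 0 < q)
    (hM : ∀ᶠ N : ℕ in atTop, c * (N : ℝ) ^ (1 + ε) ≤ (M N : ℝ))
    (hp : ∀ᶠ N : ℕ in atTop, q * Real.exp (-(N : ℝ) ^ δ) ≤ successProb T ψ (P N)) :
    Tendsto (fun N : ℕ => worstFidelity T ψ (P N)) atTop (𝓝 0) := by
  set σ : ℝ := ‖T ψ‖ ^ 2 / 4 with hσ
  have hσ0 : 0 < σ := by have := norm_pos_iff.2 hTψ; positivity
  set R : ℝ := ‖T‖ + 1 with hR
  have hR0 : 0 < R := by positivity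
  -- With `x = N^δ`, the strip bound costs `6 x`, the lower bound on `p` costs `x`, and the
  -- constants `4` and `q` cost the logarithm.
  set C : ℝ := 7 + |Real.log (4 / q)| with hC
  have hC1 : 1 ≤ C := by have := abs_nonneg (Real.log (4 / q)); linarith
  -- The spacing `N^(-β)` has `β` midway between `(1 + δ) / 2`, the Lipschitz scale, and `(1 + ε) /
  -- 2`, the resolution scale.
  set β : ℝ := 1 / 2 + (δ + ε) / 4 with hβ
  have hβ0 : 0 < β := by linarith
  refine tendsto_order.2 ⟨fun a ha => Eventually.of_forall fun N =>
    ha.trans_le (worstFidelity_nonneg (P N)), fun η hη => ?_⟩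
  -- The term `4 / J` takes half of `η`; `4 γ + 4 K` takes the other half for large `N`.
  obtain ⟨J, hJ⟩ := exists_nat_gt (8 / η)
  have hJ0 : (0 : ℝ) < J := lt_trans (by positivity) hJ
  -- The exponents are `1 + ε - 2β = (ε - δ) / 2` for the overlap and, in `K`, `(1 + δ) / 2 - β =
  -- -(ε - δ) / 4` for the drift of the output.
  set γ : ℕ → ℝ := fun N => Real.exp (-(σ * (c * (N : ℝ) ^ ((ε - δ) / 2)))) with hγ
  set K : ℕ → ℝ := fun N => Real.exp 1 * (C * R) * J * (N : ℝ) ^ (-((ε - δ) / 4)) with hK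
  have hγt : Tendsto γ atTop (𝓝 0) := by
    refine Real.tendsto_exp_atBot.comp (tendsto_neg_atTop_atBot.comp ?_)
    exact ((tendsto_natCast_rpow (by linarith)).const_mul_atTop hc).const_mul_atTop hσ0
  have hKt : Tendsto K atTop (𝓝 0) := by
    simpa using (tendsto_natCast_rpow_neg (b := (ε - δ) / 4) (by linarith)).const_mul
      (Real.exp 1 * (C * R) * J)
  have hτt : ∀ b : ℝ, Tendsto (fun N : ℕ => b * (N : ℝ) ^ (-β)) atTop (𝓝 0) := fun b => by
    simpa using (tendsto_natCast_rpow_neg hβ0).const_mul b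
  have hsmall : Tendsto (fun N => 4 * γ N + 4 * K N) atTop (𝓝 0) := by
    simpa using (hγt.const_mul 4).add (hKt.const_mul 4)
  filter_upwards [hM, hp, eventually_ge_atTop 1,
    (hKt.eventually_le_const (by norm_num : (0 : ℝ) < 1 / 4)),
    (hτt (J * R)).eventually_le_const one_pos,
    (hτt (2 * R ^ 3 * J)).eventually_le_const hσ0,
    hsmall.eventually_lt_const (half_pos hη)] with N hMN hpN hN1 hKN hτN hτN' hsN
  have hN : (1 : ℝ) ≤ N := by exact_mod_cast hN1
  have hN0 : (0 : ℝ) < N := one_pos.trans_le hN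
  set x : ℝ := (N : ℝ) ^ δ with hx
  have hx1 : 1 ≤ x := Real.one_le_rpow hN hδ0
  have hYR : (N : ℝ) ^ ((δ - 1) / 2) / R * R = (N : ℝ) ^ ((δ - 1) / 2) :=
    div_mul_cancel₀ _ hR0.ne'
  have hYx : (N : ℝ) * ((N : ℝ) ^ ((δ - 1) / 2) / R * R) ^ 2 = x := by
    rw [hYR, ← Real.rpow_natCast, ← Real.rpow_mul hN0.le, hx]
    nth_rewrite 1 [← Real.rpow_one (N : ℝ)]
    rw [← Real.rpow_add hN0]
    congr 1
    push_cast
    ring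
  have hKeq : Real.exp 1 * (C * x) / ((N : ℝ) ^ ((δ - 1) / 2) / R) * (J * (N : ℝ) ^ (-β)) =
      K N := by
    have : (N : ℝ) ^ (-((ε - δ) / 4)) = x / (N : ℝ) ^ ((δ - 1) / 2) * (N : ℝ) ^ (-β) := by
      rw [hx, ← Real.rpow_sub hN0, ← Real.rpow_add hN0]
      congr 1
      rw [hβ]
      ring
    simp only [hK, this]
    field_simp
  -- This `Y` is chosen so that `N (Y R)² = N^δ`: the growth on the strip then matches the rarity of
  -- success.
  have key := mul_worstFidelity_le (P N) hT hψ h0 (R := R) (L := C * x)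
    (Y := (N : ℝ) ^ ((δ - 1) / 2) / R) (τ := (N : ℝ) ^ (-β)) (γ := γ N)
    (by rw [hR]; linarith) (lt_of_lt_of_le (by positivity) hpN) (by positivity) ?_
    (one_le_mul_of_one_le_of_one_le hC1 hx1) ?_ J (by positivity) (by linarith) (by linarith) ?_
    (by rwa [hKeq])
  · rw [hKeq] at key
    have h1 : 8 < η * J := by rwa [div_lt_iff₀' hη] at hJ
    have h2 : J * (4 * γ N + 4 * K N) < J * (η / 2) := mul_lt_mul_of_pos_left hsN hJ0
    have h3 : J * worstFidelity T ψ (P N) < J * η := by linarith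
    exact lt_of_mul_lt_mul_left h3 hJ0.le
  -- Here `δ < ε ≤ 1` enters: it keeps `Y R` at most `1`, inside the range of the Taylor estimates.
  · rw [hYR]
    exact Real.rpow_le_one_of_one_le_of_nonpos hN (by linarith)
  · rw [hYx]
    have hlog : Real.log (4 / q) ≤ |Real.log (4 / q)| * x :=
      (le_abs_self _).trans (le_mul_of_one_le_right (abs_nonneg _) hx1)
    calc 4 * Real.exp (6 * x) = q * Real.exp (Real.log (4 / q) + 6 * x) := by
          rw [Real.exp_add, Real.exp_log (by positivity)]
          field_simp
      _ ≤ q * Real.exp (-x + C * x) := by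
          refine mul_le_mul_of_nonneg_left (Real.exp_le_exp.2 ?_) hq.le
          rw [hC]
          linarith
      _ = q * Real.exp (-x) * Real.exp (C * x) := by rw [Real.exp_add, mul_assoc]
      _ ≤ _ := by gcongr
  · refine Real.exp_le_exp.2 (neg_le_neg (mul_le_mul_of_nonneg_left ?_ hσ0.le))
    calc c * (N : ℝ) ^ ((ε - δ) / 2) = c * (N : ℝ) ^ (1 + ε) * ((N : ℝ) ^ (-β)) ^ 2 := by
          rw [← Real.rpow_natCast ((N : ℝ) ^ (-β)), ← Real.rpow_mul hN0.le, mul_assoc,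
            ← Real.rpow_add hN0]
          congr 2
          rw [hβ]
          push_cast
          ring
      _ ≤ _ := by gcongr

/-- Reduction to the centred case by subtracting the mean energy `μ = ⟨ψ, Hψ⟩`, which is real. That
`ψ` is not an eigenvector says exactly that the energy spread `‖Tψ‖` is nonzero. -/
lemma tendsto_worstFidelity {H : Op (Sys ι)} (hH : IsSelfAdjoint H) {ψ : Sys ι}
    (hψ : ‖ψ‖ = 1) (hHψ : ∀ E : ℂ, H ψ ≠ E • ψ) {ε c δ q : ℝ} {M : ℕ → ℕ}
    (P : ∀ N : ℕ, ReplicationProcess ι N (M N)) (hδ0 : 0 ≤ δ) (hδ : δ < ε) (hε : ε ≤ 1)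
    (hc : 0 < c) (hq : 0 < q)
    (hM : ∀ᶠ N : ℕ in atTop, c * (N : ℝ) ^ (1 + ε) ≤ (M N : ℝ))
    (hp : ∀ᶠ N : ℕ in atTop, q * Real.exp (-(N : ℝ) ^ δ) ≤ successProb H ψ (P N)) :
    Tendsto (fun N : ℕ => worstFidelity H ψ (P N)) atTop (𝓝 0) := by
  set μ : ℝ := (inner ℂ ψ (H ψ)).re with hμ
  have hμ' : inner ℂ ψ (H ψ) = (μ : ℂ) := by
    apply Complex.ext
    · simp [hμ]
    · have h1 := ContinuousLinearMap.adjoint_inner_left H ψ ψ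
      rw [hH.adjoint_eq, ← inner_conj_symm] at h1
      simpa using Complex.conj_eq_iff_im.1 h1
  set T : Op (Sys ι) := H - (μ : ℂ) • 1 with hT
  have hTψ : T ψ = H ψ - (μ : ℂ) • ψ := by simp [hT]
  have hTsa : IsSelfAdjoint T :=
    hH.sub (IsSelfAdjoint.smul (by simp [isSelfAdjoint_iff]) (IsSelfAdjoint.one _))
  have := tendsto_worstFidelity_of_centered hTsa hψ (by
    rw [hTψ, inner_sub_right, hμ', inner_smul_right, inner_self_eq_norm_sq_to_K, hψ]
    simp) (by rw [hTψ, sub_ne_zero]; exact hHψ μ) P hδ0 hδ hε hc hq hM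
    (by simpa only [hT, successProb_sub_smul_one] using hp)
  simpa only [hT, worstFidelity_sub_smul_one] using this

end Asymptotics

end QuantumReplication

/-! ### The two parts of the theorem. -/

open QuantumReplication
theorem mainTheorem2 {ι : Type*} [Fintype ι] (H : Op (Sys ι)) (hH : IsSelfAdjoint H)
    (ψ : Sys ι) (hψ : ‖ψ‖ = 1) (hHψ : ∀ E : ℂ, H ψ ≠ E • ψ) :
    (∀ (ε c δ : ℝ) (M : ℕ → ℕ) (P : ∀ N : ℕ, ReplicationProcess ι N (M N)),
      0 < ε → ε ≤ 1 → 0 < c → δ < ε →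
      (∀ᶠ N : ℕ in atTop, c * (N : ℝ) ^ (1 + ε) ≤ (M N : ℝ)) →
      0 < liminf (fun N : ℕ =>
        ((successProb H ψ (P N) / Real.exp (-(N : ℝ) ^ δ) : ℝ) : EReal)) atTop →
      Tendsto (fun N : ℕ => worstFidelity H ψ (P N)) atTop (𝓝 0)) ∧
    (∀ (α : ℝ) (M : ℕ → ℕ) (P : ∀ N : ℕ, ReplicationProcess ι N (M N)),
      1 < α → HasRateAtLeast M α → (∀ N : ℕ, IsDeterministic H ψ (P N)) →
      Tendsto (fun N : ℕ => worstFidelity H ψ (P N)) atTop (𝓝 0) ∧ ¬ IsReliable H ψ P) := by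
  constructor
  · intro ε c δ M P hε0 hε hc hδ hM hlim
    obtain ⟨q, hq0, hq⟩ := EReal.lt_iff_exists_real_btwn.1 hlim
    -- A negative `δ` is replaced by `0`, which only weakens the lower bound on the success
    -- probability once `N ≥ 1`.
    refine tendsto_worstFidelity hH hψ hHψ P (le_max_right δ 0) (max_lt hδ hε0) hε hc
      (by exact_mod_cast hq0) hM ?_
    filter_upwards [eventually_lt_of_lt_liminf hq, eventually_ge_atTop 1] with N hN hN1
    have hN' : q < successProb H ψ (P N) / Real.exp (-(N : ℝ) ^ δ) := by exact_mod_cast hN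
    rw [lt_div_iff₀ (Real.exp_pos _)] at hN'
    refine le_trans ?_ hN'.le
    have hq0' : 0 < q := by exact_mod_cast hq0
    have hN1' : (1 : ℝ) ≤ N := by exact_mod_cast hN1
    gcongr
    exact le_max_left δ 0
  · intro α M P hα hM hdet
    obtain ⟨a, ha, hM⟩ := hM
    have hF : Tendsto (fun N : ℕ => worstFidelity H ψ (P N)) atTop (𝓝 0) := by
      -- Certain success satisfies the bound with `δ = 0` and `q = 1`; the rate `α - 1` is capped at
      -- `1` to meet `ε ≤ 1`.
      refine tendsto_worstFidelity hH hψ hHψ P (ε := min (α - 1) 1) le_rfl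
        (lt_min (by linarith) one_pos) (min_le_right _ _) ha one_pos ?_ ?_
      · filter_upwards [hM, eventually_ge_atTop 1] with N hN hN1
        have hN1' : (1 : ℝ) ≤ N := by exact_mod_cast hN1
        have h1 : (N : ℝ) ^ (1 + min (α - 1) 1) ≤ (N : ℝ) ^ α :=
          Real.rpow_le_rpow_of_exponent_le hN1' (by linarith [min_le_left (α - 1) 1])
        have h2 := mul_le_mul_of_nonneg_left h1 ha.le
        linarith
      · refine Eventually.of_forall fun N => ?_
        have h1 : successProb H ψ (P N) = 1 := by
          have : successProbAt H ψ (P N) = fun _ => 1 := funext (hdet N)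
          simp [successProb, this]
        rw [h1, one_mul, Real.exp_le_one_iff]
        simp
    refine ⟨hF, fun hrel => ?_⟩
    have h1 : Tendsto (fun N : ℕ => 1 - worstFidelity H ψ (P N)) atTop (𝓝 (1 - 0)) :=
      hF.const_sub 1
    have := tendsto_nhds_unique hrel h1
    norm_num at this
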